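/- Let $\varphi$ be any acceptable programming system for the partial computable functions $\mathbb{N}\rightharpoonup\mathbb{N}$, i.e. $(e,x)\mapsto\varphi_e(x)$ is partial computable and for every partial computable $(e,x)\mapsto\psi_e(x)$ there is a total computable $f$ with $\varphi_{f(e)}=\psi_e$ for all $e$. Put $W_e=\mathrm{dom}(\varphi_e)$. A language is a computably enumerable set $L\subseteq\mathbb{N}$. A text is a function $T:\mathbb{N}\to\mathbb{N}\cup\{\#\}$; $T[i]$ is the finite sequence $T(0),\dots,T(i-1)$; the content of a finite or infinite sequence over $\mathbb{N}\cup\{\#\}$ is the set of natural numbers occurring in it; $T$ is a text for $L$ if $\mathrm{content}(T)=L$. A learner is a partial computable function $h$ from finite sequences over $\mathbb{N}\cup\{\#\}$ to $\mathbb{N}$; its (full-information) learning sequence on $T$ is $p(i)=h(T[i])$, $i\in\mathbb{N}$. For a learning sequence $p$ and a text $T$ define the following restrictions, each of which also requires $p$ to be total: \begin{align*} \mathbf{Ex}(p,T)&\iff \exists n_0\,\forall n\ge n_0:\ p(n)=p(n_0)\ \wedge\ W_{p(n_0)}=\mathrm{content}(T);\\ \mathbf{Conv}(p,T)&\iff \forall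 i:\ \mathrm{content}(T[i+1])\subseteq W_{p(i)}\Rightarrow p(i)=p(i+1);\\ \mathbf{WMon}(p,T)&\iff \forall i,j:\ i<j\wedge \mathrm{content}(T[j])\subseteq W_{p(i)}\Rightarrow W_{p(i)}\subseteq W_{p(j)};\\ \mathbf{Caut}(p,T)&\iff \forall i,j:\ W_{p(i)}\subsetneq W_{p(j)}\Rightarrow i<j. \end{align*} For $\delta\in\{\mathbf{Conv},\mathbf{WMon},\mathbf{Caut}\}$ let $[\mathbf{TxtG}\delta\mathbf{Ex}]$ be the set of all classes $\mathcal{L}$ of languages for which there is a single learner $h$ such that, for every $L\in\mathcal{L}$ and every text $T$ for $L$, the learning sequence $p$ of $h$ on $T$ satisfies both $\delta(p,T)$ and $\mathbf{Ex}(p,T)$. Then $$[\mathbf{TxtG}\mathbf{Conv}\mathbf{Ex}]=[\mathbf{TxtG}\mathbf{WMon}\mathbf{Ex}]=[\mathbf{TxtG}\mathbf{Caut}\mathbf{Ex}].$$ -/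

import Mathlib

namespace InductiveInference

/-- `φ` is an acceptable programming system (acceptable numbering of the partial computable
functions `ℕ ⇀ ℕ`): `φ` is an effective numbering, and every effective numbering `ψ` can be
computably translated into `φ`. In particular every partial computable function is some `φ e`. -/
def IsAcceptable (φ : ℕ → ℕ →. ℕ) : Prop :=
  Partrec₂ φ ∧
    ∀ ψ : ℕ → ℕ →. ℕ, Partrec₂ ψ → ∃ f : ℕ → ℕ, Computable f ∧ ∀ e, φ (f e) = ψ e

/-- The computably enumerable set `W_e = dom (φ_e)`. -/
def W (φ : ℕ → ℕ →. ℕ) (e : ℕ) : Set ℕ := (φ e).Dom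

/-- A language is a computably enumerable set of natural numbers. -/
def IsLanguage (L : Set ℕ) : Prop := REPred fun x => x ∈ L

/-- A text is a total function `ℕ → ℕ ∪ {#}`; the pause symbol `#` is `none`. -/
abbrev Text : Type := ℕ → Option ℕ

/-- The initial segment `T[i]`, that is, the finite sequence `T 0, …, T (i - 1)`. -/
def upTo (T : Text) (i : ℕ) : List (Option ℕ) := (List.range i).map T

/-- The content of a finite sequence: the numbers occurring in it (pauses are dropped). -/
def listContent (σ : List (Option ℕ)) : Set ℕ := {x | some x ∈ σ}

/-- The content of a text: the numbers occurring in it (pauses are dropped). -/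
def content (T : Text) : Set ℕ := {x | some x ∈ Set.range T}

/-- The interaction operator of full-information (Gold-style) learning:
the `i`-th hypothesis is `h (T[i])`. -/
def gold (h : List (Option ℕ) →. ℕ) (T : Text) : ℕ →. ℕ := fun i => h (upTo T i)

/-- A learning restriction is a predicate on a (partial) learning sequence and a text. -/
abbrev Restriction : Type := (ℕ →. ℕ) → Text → Prop

/-- The restriction "`p` is total and `δ p T`", for `δ` a predicate on total sequences. -/
def whenTotal (δ : (ℕ → ℕ) → Text → Prop) : Restriction := fun p T =>
  ∃ q : ℕ → ℕ, (∀ i, q i ∈ p i) ∧ δ q T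

/-- Explanatory learning: syntactic convergence to a correct hypothesis. -/
def Ex (φ : ℕ → ℕ →. ℕ) : Restriction := whenTotal fun p T =>
  ∃ n₀, ∀ n, n₀ ≤ n → p n = p n₀ ∧ W φ (p n₀) = content T

/-- Conservative learning: a hypothesis consistent with the next data is not changed. -/
def Conv (φ : ℕ → ℕ →. ℕ) : Restriction := whenTotal fun p T =>
  ∀ i, listContent (upTo T (i + 1)) ⊆ W φ (p i) → p i = p (i + 1)

/-- Weakly monotone learning: the conjectured set only grows while it is consistent. -/
def WMon (φ : ℕ → ℕ →. ℕ) : Restriction := whenTotal fun p T =>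
  ∀ i j, i < j ∧ listContent (upTo T j) ⊆ W φ (p i) → W φ (p i) ⊆ W φ (p j)

/-- Cautious learning: no conjecture is a proper subset of an earlier conjecture. -/
def Caut (φ : ℕ → ℕ →. ℕ) : Restriction := whenTotal fun p _T =>
  ∀ i j, W φ (p i) ⊂ W φ (p j) → i < j

/-- The learner `h` learns `L` under `δ`: on every text for `L`, the learning sequence
satisfies `δ`. -/
def Learns (δ : Restriction) (h : List (Option ℕ) →. ℕ) (L : Set ℕ) : Prop :=
  ∀ T : Text, content T = L → δ (gold h T) T

/-- `[TxtGδ]`: the collection of all classes of languages such that a single partial computable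
learner learns every member of the class under `δ`. -/
def TxtG (δ : Restriction) : Set (Set (Set ℕ)) :=
  {𝓛 | (∀ L ∈ 𝓛, IsLanguage L) ∧
    ∃ h : List (Option ℕ) →. ℕ, Partrec h ∧ ∀ L ∈ 𝓛, Learns δ h L}

end InductiveInference

/-! All three restrictions forbid a learner that succeeds on `L` to conjecture a proper superset of
`L` on data from `L`. Such a conjecture could never be contradicted, so weak monotonicity would keep
the final hypothesis too large, and caution would forbid the final hypothesis itself.
Conservativeness implies weak monotonicity directly. It remains to turn a learner that never
overgeneralises its target, made total by `exists_targetCautious`, into one that is both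
conservative and cautious.

From data `ρ`, take the least sequence `σ` over its content that looks stabilising for `H`, and put
`e = H σ`. Conjecture the content of `ρ` together with the approximations to `W_e` that contain it,
stopping once some sequence over the approximation, of code at most the stage, makes `H` change its
mind after `σ`. A conjecture is dropped only when the data show such a mind change and are not
covered by what has been enumerated so far. The cutoff ensures that anything the conjecture would
enumerate later excludes this mind change, so the data are really inconsistent with it
(`Refuted.not_subset`). This gives conservativeness. The new conjecture contains the refuting data,
so it is not contained in any earlier different one (`base_eq_or_not_subset`), which gives caution.

A stabilising sequence bounds the selected codes on a text for `L`, and late refutations strictly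
increase them, so the conjectures converge (`exists_base_eventually_eq`). The limit is not a proper
superset of `L`. If it missed an element of `L`, then either the selected sequence would be
stabilising and the conjecture equal to `L` after all, or the conjecture would be refuted
(`conjecture_eq_of_base_eventually_eq`). -/

namespace InductiveInference

open Nat.Partrec (Code)

/-! ### Finite sequences, texts and locking sequences -/

/-- The finite sequence with code `n` (the empty one if `n` is not a code). -/
def decodeSeq (n : ℕ) : List (Option ℕ) := (Encodable.decode n).getD []

theorem decodeSeq_encode (σ : List (Option ℕ)) : decodeSeq (Encodable.encode σ) = σ := by
  simp [decodeSeq]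

theorem decodeSeq_zero : decodeSeq 0 = [] := by
  simp [decodeSeq]

theorem upTo_zero (T : Text) : upTo T 0 = [] := rfl

theorem upTo_succ (T : Text) (i : ℕ) : upTo T (i + 1) = upTo T i ++ [T i] := by
  simp [upTo, List.range_succ]

theorem length_upTo (T : Text) (i : ℕ) : (upTo T i).length = i := by
  simp [upTo]

theorem listContent_append (σ τ : List (Option ℕ)) :
    listContent (σ ++ τ) = listContent σ ∪ listContent τ := by
  ext x; simp [listContent]

theorem listContent_nil : listContent [] = ∅ := by
  ext x; simp [listContent]

theorem listContent_finite (σ : List (Option ℕ)) : (listContent σ).Finite :=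
  (σ.finite_toSet.preimage (Option.some_injective ℕ).injOn)

theorem mem_listContent_upTo {T : Text} {i x : ℕ} :
    x ∈ listContent (upTo T i) ↔ ∃ j < i, T j = some x := by
  simp [listContent, upTo]

theorem listContent_upTo_mono (T : Text) : Monotone fun i => listContent (upTo T i) := by
  intro i j hij x hx
  obtain ⟨k, hk, h⟩ := mem_listContent_upTo.1 hx
  exact mem_listContent_upTo.2 ⟨k, hk.trans_le hij, h⟩

theorem listContent_upTo_subset (T : Text) (i : ℕ) : listContent (upTo T i) ⊆ content T := by
  intro x hx
  obtain ⟨k, -, h⟩ := mem_listContent_upTo.1 hx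
  exact ⟨k, h⟩

theorem take_upTo (T : Text) {i k : ℕ} (h : k ≤ i) : (upTo T i).take k = upTo T k := by
  simp [upTo, ← List.map_take, List.take_range, h]

theorem exists_subset_listContent_upTo {T : Text} {S : Set ℕ} (hS : S.Finite)
    (h : S ⊆ content T) : ∃ n, S ⊆ listContent (upTo T n) := by
  induction S, hS using Set.Finite.induction_on with
  | empty => exact ⟨0, Set.empty_subset _⟩
  | @insert a S _ _ ih =>
    obtain ⟨n, hn⟩ := ih ((Set.subset_insert _ _).trans h)
    obtain ⟨k, hk⟩ := h (Set.mem_insert a S)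
    refine ⟨max n (k + 1), Set.insert_subset ?_ ?_⟩
    · exact mem_listContent_upTo.2 ⟨k, by omega, hk⟩
    · exact hn.trans (listContent_upTo_mono T (le_max_left _ _))

theorem exists_content_eq (L : Set ℕ) : ∃ T : Text, content T = L := by
  classical
  refine ⟨fun n => if n ∈ L then some n else none, Set.ext fun x => ?_⟩
  simp [content]

/-- The text that first presents `σ` and then `T`. -/
def prepend (σ : List (Option ℕ)) (T : Text) : Text :=
  fun i => if h : i < σ.length then σ[i] else T (i - σ.length)

theorem upTo_prepend (σ : List (Option ℕ)) (T : Text) (n : ℕ) :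
    upTo (prepend σ T) (σ.length + n) = σ ++ upTo T n := by
  apply List.ext_getElem
  · simp [upTo]
  · intro i h₁ h₂
    simp only [upTo, prepend, List.getElem_map, List.getElem_range, List.getElem_append]

theorem content_prepend (σ : List (Option ℕ)) (T : Text) :
    content (prepend σ T) = listContent σ ∪ content T := by
  ext x
  constructor
  · rintro ⟨i, hi⟩
    have h : x ∈ listContent (upTo (prepend σ T) (σ.length + (i + 1))) :=
      mem_listContent_upTo.2 ⟨i, by omega, hi⟩
    rw [upTo_prepend, listContent_append] at h
    exact h.imp id fun h => listContent_upTo_subset T _ h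
  · intro h
    obtain ⟨n, hn⟩ : ∃ n, x ∈ listContent (σ ++ upTo T n) := by
      rw [Set.mem_union] at h
      simp only [listContent_append, Set.mem_union]
      rcases h with h | ⟨i, hi⟩
      · exact ⟨0, .inl h⟩
      · exact ⟨i + 1, .inr (mem_listContent_upTo.2 ⟨i, by omega, hi⟩)⟩
    rw [← upTo_prepend] at hn
    exact listContent_upTo_subset _ _ hn

/-- Every sequence over `L` is an initial segment of a text for `L`. -/
theorem exists_text_extending {L : Set ℕ} {σ : List (Option ℕ)} (hσ : listContent σ ⊆ L) :
    ∃ T : Text, content T = L ∧ upTo T σ.length = σ := by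
  obtain ⟨T, hT⟩ := exists_content_eq L
  refine ⟨prepend σ T, by rw [content_prepend, hT, Set.union_eq_right.2 hσ], ?_⟩
  simpa [upTo_zero] using upTo_prepend σ T 0

/-- A total learner whose hypotheses stabilise on every text for `L` has a stabilising sequence. -/
theorem exists_stabilising {H : List (Option ℕ) → ℕ} {L : Set ℕ}
    (hH : ∀ T : Text, content T = L → ∃ n₀, ∀ n ≥ n₀, H (upTo T n) = H (upTo T n₀)) :
    ∃ σ, listContent σ ⊆ L ∧ ∀ τ, listContent τ ⊆ L → H (σ ++ τ) = H σ := by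
  by_contra! hcon
  choose! next hnext hne using hcon
  obtain ⟨T₀, hT₀⟩ := exists_content_eq L
  -- Interleaving a text for `L` with mind-changing extensions yields a text for `L` on which `H`
  -- never settles.
  let ext (n : ℕ) (σ : List (Option ℕ)) := σ ++ [T₀ n] ++ next (σ ++ [T₀ n])
  let s : ℕ → List (Option ℕ) := fun n => Nat.rec [] ext n
  have hs : ∀ n, s (n + 1) = s n ++ [T₀ n] ++ next (s n ++ [T₀ n]) := fun n => rfl
  have hadd : ∀ n, listContent [T₀ n] ⊆ L := by
    intro n x hx
    rw [← hT₀]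
    exact ⟨n, by simpa [listContent, eq_comm] using hx⟩
  have hsL : ∀ n, listContent (s n) ⊆ L := by
    intro n
    induction n with
    | zero => simp [s, listContent_nil]
    | succ n ih =>
      have : listContent (s n ++ [T₀ n]) ⊆ L := by
        rw [listContent_append]; exact Set.union_subset ih (hadd n)
      rw [hs, listContent_append]
      exact Set.union_subset this (hnext _ this)
  have hpre : ∀ m n, m ≤ n → s m <+: s n := by
    intro m n hmn
    induction n, hmn using Nat.le_induction with
    | base => exact List.prefix_rfl
    | succ n _ ih => exact ih.trans (by rw [hs, List.append_assoc]; exact List.prefix_append _ _)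
  have hlen : ∀ n, n ≤ (s n).length := by
    intro n
    induction n with
    | zero => simp
    | succ n ih => rw [hs]; simp; omega
  -- The default `none` is never used, because `s (i + 1)` has length greater than `i`.
  let T : Text := fun i => (s (i + 1)).getD i none
  have hget : ∀ i n, i < (s n).length → T i = (s n).getD i none := by
    intro i n hi
    have hi' : i < (s (i + 1)).length := hlen (i + 1)
    have : (s n)[i]? = (s (i + 1))[i]? := by
      rcases le_total n (i + 1) with h | h
      · obtain ⟨t, ht⟩ := hpre _ _ h
        rw [← ht, List.getElem?_append_left hi]
      · obtain ⟨t, ht⟩ := hpre _ _ h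
        rw [← ht, List.getElem?_append_left hi']
    simp [T, List.getD_eq_getElem?_getD, this]
  have hup : ∀ t n, t <+: s n → upTo T t.length = t := by
    rintro t n ⟨u, hu⟩
    apply List.ext_getElem (by simp [upTo])
    intro i h₁ h₂
    have hi : i < (s n).length := by rw [← hu]; simp; omega
    simp only [upTo, List.getElem_map, List.getElem_range]
    rw [hget i n hi, ← hu]
    simp [List.getD_eq_getElem?_getD, List.getElem?_append_left h₂, h₂]
  have hT : content T = L := by
    ext x
    constructor
    · rintro ⟨i, hi⟩
      have : x ∈ listContent (upTo T (s (i + 1)).length) :=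
        mem_listContent_upTo.2 ⟨i, hlen (i + 1), hi⟩
      rw [hup _ (i + 1) List.prefix_rfl] at this
      exact hsL (i + 1) this
    · intro hx
      rw [← hT₀] at hx
      obtain ⟨n, hn⟩ := hx
      have : x ∈ listContent (s (n + 1)) := by
        rw [hs]; simp [listContent, hn]
      rw [← hup _ (n + 1) List.prefix_rfl] at this
      exact listContent_upTo_subset _ _ this
  obtain ⟨n₀, hn₀⟩ := hH T hT
  have hL : listContent (s n₀ ++ [T₀ n₀]) ⊆ L := by
    rw [listContent_append]; exact Set.union_subset (hsL _) (hadd _)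
  apply hne _ hL
  have h₁ := hup (s n₀ ++ [T₀ n₀]) (n₀ + 1) (by rw [hs]; exact List.prefix_append _ _)
  have h₂ := hup _ (n₀ + 1) List.prefix_rfl
  have e₁ := hn₀ (s n₀ ++ [T₀ n₀]).length (by have := hlen n₀; simp; omega)
  have e₂ := hn₀ (s (n₀ + 1)).length (by have := hlen (n₀ + 1); omega)
  rw [h₁] at e₁
  rw [h₂] at e₂
  rw [← hs, e₁, e₂]

/-! ### Target-cautious learning -/

/-- The total learner `H` learns `L` explanatorily from text, and no sequence over `L` makes it
conjecture a proper superset of `L`. -/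
structure TargetCautious (φ : ℕ → ℕ →. ℕ) (H : List (Option ℕ) → ℕ) (L : Set ℕ) : Prop where
  converges : ∀ T : Text, content T = L →
    ∃ n₀, ∀ n ≥ n₀, H (upTo T n) = H (upTo T n₀) ∧ W φ (H (upTo T n₀)) = L
  not_ssubset : ∀ σ, listContent σ ⊆ L → ¬ L ⊂ W φ (H σ)

/-- On `σ` followed by a text for `L` the hypothesis stays `H σ` forever, so `H σ` is the correct
limit. -/
theorem TargetCautious.W_eq {φ : ℕ → ℕ →. ℕ} {H : List (Option ℕ) → ℕ} {L : Set ℕ}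
    (hH : TargetCautious φ H L) {σ : List (Option ℕ)} (hσ : listContent σ ⊆ L)
    (h : ∀ τ, listContent τ ⊆ L → H (σ ++ τ) = H σ) : W φ (H σ) = L := by
  obtain ⟨T, hT⟩ := exists_content_eq L
  obtain ⟨n₀, hn₀⟩ := hH.converges (prepend σ T)
    (by rw [content_prepend, hT, Set.union_eq_right.2 hσ])
  obtain ⟨e, hW⟩ := hn₀ (σ.length + n₀) (by omega)
  rw [← e, upTo_prepend, h _ (hT ▸ listContent_upTo_subset T n₀)] at hW
  exact hW

/-! ### The cautious and conservative learner -/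

section Construction

variable (H : List (Option ℕ) → ℕ) (V : ℕ → ℕ → Set ℕ)

/-- Some sequence over the content of `ρ`, with code at most the length of `ρ`, makes `H` change
its mind after `σ`. -/
def Mismatch (σ ρ : List (Option ℕ)) : Prop :=
  ∃ c < ρ.length + 1, listContent (decodeSeq c) ⊆ listContent ρ ∧ H (σ ++ decodeSeq c) ≠ H σ

/-- `c` codes a sequence over the content of `ρ` that looks stabilising in view of `ρ`. -/
def LooksStable (ρ : List (Option ℕ)) (c : ℕ) : Prop :=
  listContent (decodeSeq c) ⊆ listContent ρ ∧ ¬ Mismatch H (decodeSeq c) ρ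

open Classical in
/-- The least code of a sequence that looks stabilising in view of `ρ`. -/
noncomputable def selectedCode (ρ : List (Option ℕ)) : ℕ :=
  ((List.range (ρ.length + 1)).filter fun c => LooksStable H ρ c).headI

/-- The sequence with code `selectedCode H ρ`. -/
noncomputable def selected (ρ : List (Option ℕ)) : List (Option ℕ) := decodeSeq (selectedCode H ρ)

/-- At stage `k` the approximation `V e k` to the hypothesis `e = H (selected H ρ)` contains the
content of `ρ`, and `selected H ρ` still looks stabilising on it. -/
def GoodStage (ρ : List (Option ℕ)) (k : ℕ) : Prop :=
  listContent ρ ⊆ V (H (selected H ρ)) k ∧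
    ∀ c < k + 1, listContent (decodeSeq c) ⊆ V (H (selected H ρ)) k →
      H (selected H ρ ++ decodeSeq c) = H (selected H ρ)

/-- The language conjectured on the basis of `ρ`. -/
def conjecture (ρ : List (Option ℕ)) : Set ℕ :=
  {x | x ∈ listContent ρ ∨ ∃ k, GoodStage H V ρ k ∧ x ∈ V (H (selected H ρ)) k}

/-- The part of `conjecture H V ρ` that is enumerated before stage `n`. -/
def conjectureBefore (ρ : List (Option ℕ)) (n : ℕ) : Set ℕ :=
  {x | x ∈ listContent ρ ∨ ∃ k < n, GoodStage H V ρ k ∧ x ∈ V (H (selected H ρ)) k}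

/-- The data `ρ` refutes the conjecture made on the basis of `ρ₀`. -/
def Refuted (ρ₀ ρ : List (Option ℕ)) : Prop :=
  Mismatch H (selected H ρ₀) ρ ∧ ¬ listContent ρ ⊆ conjectureBefore H V ρ₀ (ρ.length + 1)

open Classical in
/-- One step of the computation of `base`: read a datum and replace a refuted base. -/
noncomputable def baseStep (s : List (Option ℕ) × List (Option ℕ)) (a : Option ℕ) :
    List (Option ℕ) × List (Option ℕ) :=
  (s.1 ++ [a], if Refuted H V s.2 (s.1 ++ [a]) then s.1 ++ [a] else s.2)

/-- The initial segment of `ρ` on whose basis the current conjecture was made. -/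
noncomputable def base (ρ : List (Option ℕ)) : List (Option ℕ) :=
  (ρ.foldl (baseStep H V) ([], [])).2

open Classical in
theorem base_concat (ρ : List (Option ℕ)) (a : Option ℕ) :
    base H V (ρ ++ [a]) =
      if Refuted H V (base H V ρ) (ρ ++ [a]) then ρ ++ [a] else base H V ρ := by
  have h : ∀ ρ : List (Option ℕ), (ρ.foldl (baseStep H V) ([], [])).1 = ρ := by
    intro ρ
    induction ρ using List.reverseRecOn with
    | nil => rfl
    | append_singleton ρ a ih => rw [List.foldl_append]; simp [baseStep, ih]
  rw [base, List.foldl_append, List.foldl_cons, List.foldl_nil, baseStep, h]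
  rfl

theorem base_nil : base H V [] = [] := rfl

/-! ### Selected sequences, and refutation as inconsistency -/

variable {H V}

theorem Mismatch.mono {σ ρ ρ' : List (Option ℕ)} (h : Mismatch H σ ρ)
    (hl : ρ.length ≤ ρ'.length) (hc : listContent ρ ⊆ listContent ρ') : Mismatch H σ ρ' := by
  obtain ⟨c, hcl, hcc, hne⟩ := h
  exact ⟨c, by omega, hcc.trans hc, hne⟩

-- Filtering a range preserves its order, so the head of the list is the least candidate.
open Classical in
theorem selectedCode_le {ρ : List (Option ℕ)} {c : ℕ} (hc : c ≤ ρ.length)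
    (h : LooksStable H ρ c) :
    selectedCode H ρ ≤ c ∧ LooksStable H ρ (selectedCode H ρ) := by
  have hmem : c ∈ (List.range (ρ.length + 1)).filter fun c => LooksStable H ρ c := by
    simp [h]; omega
  have hpw : ((List.range (ρ.length + 1)).filter fun c => LooksStable H ρ c).Pairwise (· < ·) :=
    List.Pairwise.filter _ List.pairwise_lt_range
  have hall : ∀ d ∈ (List.range (ρ.length + 1)).filter fun c => LooksStable H ρ c,
      LooksStable H ρ d := by
    intro d hd
    simpa using (List.mem_filter.1 hd).2
  unfold selectedCode
  generalize ((List.range (ρ.length + 1)).filter fun c => LooksStable H ρ c) = l at *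
  cases l with
  | nil => simp at hmem
  | cons d l =>
    refine ⟨?_, hall d (by simp)⟩
    rcases List.mem_cons.1 hmem with h | h
    · exact h.ge
    · exact ((List.pairwise_cons.1 hpw).1 c h).le

open Classical in
theorem listContent_selected_subset (ρ : List (Option ℕ)) :
    listContent (selected H ρ) ⊆ listContent ρ := by
  have hall : ∀ d ∈ (List.range (ρ.length + 1)).filter fun c => LooksStable H ρ c,
      LooksStable H ρ d := by
    intro d hd
    simpa using (List.mem_filter.1 hd).2
  unfold selected selectedCode
  generalize ((List.range (ρ.length + 1)).filter fun c => LooksStable H ρ c) = l at *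
  cases l with
  | nil =>
    -- Without a candidate, `headI` defaults to `0`, which decodes to the empty sequence.
    show listContent (decodeSeq 0) ⊆ _
    rw [decodeSeq_zero, listContent_nil]
    exact Set.empty_subset _
  | cons d l => exact (hall d (by simp)).1

theorem listContent_subset_conjecture (ρ : List (Option ℕ)) :
    listContent ρ ⊆ conjecture H V ρ := fun _ hx => .inl hx

/-- Approximations increase with the stage and every good stage already contains the content of
`ρ₀`, so the finitely many witnesses merge into one good stage. -/
theorem exists_stage_of_subset (hV : ∀ e, Monotone (V e)) {ρ₀ : List (Option ℕ)} {S : Set ℕ}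
    (hS : S.Finite) (h : S ⊆ conjecture H V ρ₀) :
    S ⊆ listContent ρ₀ ∨ ∃ k, GoodStage H V ρ₀ k ∧ S ⊆ V (H (selected H ρ₀)) k := by
  induction S, hS using Set.Finite.induction_on with
  | empty => exact .inl (Set.empty_subset _)
  | @insert a S _ _ ih =>
    have ha := h (Set.mem_insert a S)
    rcases ih ((Set.subset_insert _ _).trans h) with hS | ⟨k, hk, hS⟩ <;>
      rcases ha with ha | ⟨l, hl, ha⟩
    · exact .inl (Set.insert_subset ha hS)
    · exact .inr ⟨l, hl, Set.insert_subset ha (hS.trans hl.1)⟩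
    · exact .inr ⟨k, hk, Set.insert_subset (hk.1 ha) hS⟩
    · rcases le_total k l with hkl | hkl
      · exact .inr ⟨l, hl, Set.insert_subset ha (hS.trans (hV _ hkl))⟩
      · exact .inr ⟨k, hk, Set.insert_subset (hV _ hkl ha) hS⟩

/-- Refuted conjectures are inconsistent with the data. -/
theorem Refuted.not_subset (hV : ∀ e, Monotone (V e)) {ρ₀ ρ : List (Option ℕ)}
    (h : Refuted H V ρ₀ ρ) : ¬ listContent ρ ⊆ conjecture H V ρ₀ := by
  intro hsub
  obtain ⟨⟨c, hcl, hcc, hne⟩, hnot⟩ := h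
  rcases exists_stage_of_subset hV (listContent_finite ρ) hsub with hS | ⟨k, hk, hS⟩
  · exact hnot fun x hx => .inl (hS hx)
  · rcases lt_or_ge k (ρ.length + 1) with hlt | hge
    · exact hnot fun x hx => .inr ⟨k, hlt, hk, hS hx⟩
    -- The code of the mind change is at most the length of `ρ`, so a good stage this late has
    -- already tested it.
    · exact hne (hk.2 c (by omega) (hcc.trans hS))

/-! ### Size and correctness of a single conjecture -/

variable {φ : ℕ → ℕ →. ℕ} {L : Set ℕ}

/-- Without a good stage the conjecture is just the data. With one, it lies inside the hypothesis of
`H` on a sequence over `L`, which does not overgeneralise. -/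
theorem not_ssubset_conjecture (hW : ∀ e, W φ e = ⋃ k, V e k) (hH : TargetCautious φ H L)
    {ρ : List (Option ℕ)} (hρ : listContent ρ ⊆ L) : ¬ L ⊂ conjecture H V ρ := by
  rintro ⟨hsub, hnot⟩
  have hex : ∃ k, GoodStage H V ρ k := by
    by_contra! hno
    refine hnot fun x hx => ?_
    rcases hx with hx | ⟨k, hk, -⟩
    · exact hρ hx
    · exact absurd hk (hno k)
  obtain ⟨k₀, hk₀⟩ := hex
  have hcW : conjecture H V ρ ⊆ W φ (H (selected H ρ)) := by
    rw [hW]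
    rintro x (hx | ⟨k, -, hx⟩)
    · exact Set.mem_iUnion.2 ⟨k₀, hk₀.1 hx⟩
    · exact Set.mem_iUnion.2 ⟨k, hx⟩
  exact hH.not_ssubset (selected H ρ) ((listContent_selected_subset ρ).trans hρ)
    ⟨hsub.trans hcW, fun h => hnot (hcW.trans h)⟩

/-- Every approximation to `W φ (H (selected H ρ)) = L` consists of elements of `L`, so no mind
change ever occurs and all stages that cover `ρ` are good. -/
theorem conjecture_eq_of_stable (hV : ∀ e, Monotone (V e)) (hW : ∀ e, W φ e = ⋃ k, V e k)
    (hH : TargetCautious φ H L) {ρ : List (Option ℕ)} (hρ : listContent ρ ⊆ L)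
    (h : ∀ τ, listContent τ ⊆ L → H (selected H ρ ++ τ) = H (selected H ρ)) :
    conjecture H V ρ = L := by
  have hL := hH.W_eq ((listContent_selected_subset ρ).trans hρ) h
  rw [hW] at hL
  have hVL : ∀ k, V (H (selected H ρ)) k ⊆ L := fun k => hL ▸ Set.subset_iUnion _ k
  have hk₀ : ∃ k₀, listContent ρ ⊆ V (H (selected H ρ)) k₀ := by
    have hsub : listContent ρ ⊆ ⋃ k, V (H (selected H ρ)) k := hL ▸ hρ
    obtain ⟨I, hI, hsub⟩ := Set.finite_subset_iUnion (listContent_finite ρ) hsub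
    obtain ⟨k₀, hk₀⟩ := hI.bddAbove
    exact ⟨k₀, hsub.trans (Set.iUnion₂_subset fun k hk => hV _ (hk₀ hk))⟩
  obtain ⟨k₀, hk₀⟩ := hk₀
  apply Set.Subset.antisymm
  · rintro x (hx | ⟨k, -, hx⟩)
    · exact hρ hx
    · exact hVL k hx
  · intro x hx
    rw [← hL] at hx
    obtain ⟨k, hk⟩ := Set.mem_iUnion.1 hx
    refine .inr ⟨max k k₀, ⟨hk₀.trans (hV _ (le_max_right _ _)), fun c _ hc => ?_⟩,
      hV _ (le_max_left _ _) hk⟩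
    exact h _ (hc.trans (hVL _))

/-! ### The base along a text -/

theorem base_upTo_succ_of_refuted {T : Text} {i : ℕ}
    (h : Refuted H V (base H V (upTo T i)) (upTo T (i + 1))) :
    base H V (upTo T (i + 1)) = upTo T (i + 1) := by
  rw [upTo_succ] at h ⊢
  rw [base_concat, if_pos h]

theorem base_upTo_succ_of_not_refuted {T : Text} {i : ℕ}
    (h : ¬ Refuted H V (base H V (upTo T i)) (upTo T (i + 1))) :
    base H V (upTo T (i + 1)) = base H V (upTo T i) := by
  rw [upTo_succ] at h ⊢
  rw [base_concat, if_neg h]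

theorem listContent_base_subset (T : Text) (i : ℕ) :
    listContent (base H V (upTo T i)) ⊆ listContent (upTo T i) := by
  induction i with
  | zero => rw [upTo_zero, base_nil, listContent_nil]
  | succ i ih =>
    by_cases h : Refuted H V (base H V (upTo T i)) (upTo T (i + 1))
    · rw [base_upTo_succ_of_refuted h]
    · rw [base_upTo_succ_of_not_refuted h]
      exact ih.trans (listContent_upTo_mono T (Nat.le_succ i))

/-- A new conjecture is never contained in an earlier one. -/
theorem base_eq_or_not_subset (hV : ∀ e, Monotone (V e)) (T : Text) {i j : ℕ} (hij : i ≤ j) :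
    base H V (upTo T j) = base H V (upTo T i) ∨
      ¬ listContent (base H V (upTo T j)) ⊆ conjecture H V (base H V (upTo T i)) := by
  induction j, hij using Nat.le_induction with
  | base => exact .inl rfl
  | succ j hij ih =>
    by_cases h : Refuted H V (base H V (upTo T j)) (upTo T (j + 1))
    · right
      rw [base_upTo_succ_of_refuted h]
      rcases ih with ih | ih
      · exact ih ▸ h.not_subset hV
      -- Data only accumulate, so whatever escaped the earlier conjecture is also in the new base.
      · exact fun hsub => ih <| (listContent_base_subset T j).trans <|
          (listContent_upTo_mono T (Nat.le_succ j)).trans hsub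
    · rwa [base_upTo_succ_of_not_refuted h]

/-- The bases used on a text for `L` converge. -/
theorem exists_base_eventually_eq (hH : TargetCautious φ H L) {T : Text} (hT : content T = L) :
    ∃ n₀, ∀ n ≥ n₀, base H V (upTo T n) = base H V (upTo T n₀) := by
  obtain ⟨σ, hσ, hstab⟩ := exists_stabilising (H := H) (L := L) fun T hT =>
    (hH.converges T hT).imp fun n₀ h n hn => (h n hn).1
  subst hT
  set c₀ := Encodable.encode σ with hc₀
  have hdec : decodeSeq c₀ = σ := decodeSeq_encode σ
  -- From `m₁` on, the contents of all sequences over the target with code at most `c₀` have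
  -- appeared.
  obtain ⟨m₁, hm₁⟩ : ∃ n, ∀ c ≤ c₀, listContent (decodeSeq c) ⊆ content T →
      listContent (decodeSeq c) ⊆ listContent (upTo T n) := by
    obtain ⟨n, hn⟩ := exists_subset_listContent_upTo (T := T)
      (S := ⋃ c ∈ {c | c ≤ c₀ ∧ listContent (decodeSeq c) ⊆ content T}, listContent (decodeSeq c))
      (((Set.finite_Iic c₀).subset fun c hc => hc.1).biUnion fun c _ => listContent_finite _)
      (Set.iUnion₂_subset fun c hc => hc.2)
    exact ⟨n, fun c hc hcT => (Set.subset_biUnion_of_mem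
      (u := fun c => listContent (decodeSeq c))
      (show c ∈ {c | c ≤ c₀ ∧ listContent (decodeSeq c) ⊆ content T} from ⟨hc, hcT⟩)).trans hn⟩
  have hsel : ∀ n ≥ max m₁ c₀, selectedCode H (upTo T n) ≤ c₀ ∧
      LooksStable H (upTo T n) (selectedCode H (upTo T n)) := by
    intro n hn
    refine selectedCode_le (by rw [length_upTo]; omega) ⟨?_, ?_⟩
    · exact (hm₁ c₀ le_rfl (hdec ▸ hσ)).trans (listContent_upTo_mono T (by omega))
    · rintro ⟨c, -, hc, hne⟩
      rw [hdec] at hne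
      exact hne (hstab _ (hc.trans (listContent_upTo_subset T n)))
  -- The sequence selected at `n` already looked stable at `m`, so the earlier least code is no
  -- larger. The two differ, since the refutation exhibits a mind change after the earlier one.
  have hlt : ∀ m n, max m₁ c₀ ≤ m → m ≤ n → Refuted H V (upTo T m) (upTo T n) →
      selectedCode H (upTo T m) < selectedCode H (upTo T n) := by
    intro m n hm hmn href
    obtain ⟨hle, hst⟩ := hsel n (hm.trans hmn)
    have hst' : LooksStable H (upTo T m) (selectedCode H (upTo T n)) := by
      refine ⟨(hm₁ _ hle (hst.1.trans (listContent_upTo_subset T n))).trans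
        (listContent_upTo_mono T (by omega)), fun hmis => hst.2 ?_⟩
      exact hmis.mono (by simpa [length_upTo] using hmn) (listContent_upTo_mono T hmn)
    refine lt_of_le_of_ne (selectedCode_le ?_ hst').1 fun heq => hst.2 ?_
    · rw [length_upTo]; omega
    · rw [← heq]; exact href.1
  by_cases hall : ∀ n ≥ max m₁ c₀, ¬ Refuted H V (base H V (upTo T n)) (upTo T (n + 1))
  · refine ⟨max m₁ c₀, fun n hn => ?_⟩
    induction n, hn using Nat.le_induction with
    | base => rfl
    | succ n hn ih => rw [base_upTo_succ_of_not_refuted (hall n hn), ih]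
  push Not at hall
  obtain ⟨n₂, hn₂, href₂⟩ := hall
  -- One late refutation replaces an arbitrary early base by a segment long enough for `hlt`.
  have hbase : ∀ n ≥ n₂ + 1, ∃ m ≤ n, max m₁ c₀ ≤ m ∧ base H V (upTo T n) = upTo T m := by
    intro n hn
    induction n, hn using Nat.le_induction with
    | base => exact ⟨n₂ + 1, le_rfl, by omega, base_upTo_succ_of_refuted href₂⟩
    | succ n hn ih =>
      by_cases h : Refuted H V (base H V (upTo T n)) (upTo T (n + 1))
      · exact ⟨n + 1, le_rfl, by omega, base_upTo_succ_of_refuted h⟩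
      · obtain ⟨m, hmn, hm, he⟩ := ih
        exact ⟨m, by omega, hm, by rw [base_upTo_succ_of_not_refuted h, he]⟩
  -- Codes are bounded by `c₀`; once the maximum is attained, a further refutation would exceed it.
  obtain ⟨n₀, hn₀, hmax⟩ : ∃ n₀ ≥ n₂ + 1, ∀ n ≥ n₂ + 1,
      selectedCode H (base H V (upTo T n)) ≤ selectedCode H (base H V (upTo T n₀)) := by
    have hfin : {c | ∃ n ≥ n₂ + 1, selectedCode H (base H V (upTo T n)) = c}.Finite := by
      refine (Set.finite_Iic c₀).subset ?_
      rintro _ ⟨n, hn, rfl⟩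
      obtain ⟨m, -, hm, he⟩ := hbase n hn
      rw [he]
      exact (hsel m hm).1
    obtain ⟨c, ⟨n₀, hn₀, rfl⟩, h⟩ := Set.exists_max_image _ id hfin ⟨_, n₂ + 1, le_rfl, rfl⟩
    exact ⟨n₀, hn₀, fun n hn => h _ ⟨n, hn, rfl⟩⟩
  refine ⟨n₀, fun n hn => ?_⟩
  induction n, hn using Nat.le_induction with
  | base => rfl
  | succ n hn ih =>
    by_cases h : Refuted H V (base H V (upTo T n)) (upTo T (n + 1))
    · exfalso
      have hle := hmax (n + 1) (by omega)
      obtain ⟨m, hmn, hm, he⟩ := hbase n (by omega)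
      rw [← ih, base_upTo_succ_of_refuted h, he] at hle
      rw [he] at h
      exact absurd (hlt m (n + 1) hm (by omega) h) (by omega)
    · rw [base_upTo_succ_of_not_refuted h, ih]

/-- If the base converges on a text for `L`, the final conjecture is `L`. -/
theorem conjecture_eq_of_base_eventually_eq (hV : ∀ e, Monotone (V e))
    (hW : ∀ e, W φ e = ⋃ k, V e k) (hH : TargetCautious φ H L) {T : Text} (hT : content T = L)
    {n₀ : ℕ} (h₀ : ∀ n ≥ n₀, base H V (upTo T n) = base H V (upTo T n₀)) :
    conjecture H V (base H V (upTo T n₀)) = L := by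
  subst hT
  have hρ : listContent (base H V (upTo T n₀)) ⊆ content T :=
    (listContent_base_subset T n₀).trans (listContent_upTo_subset T n₀)
  by_cases hstab : ∀ τ, listContent τ ⊆ content T →
      H (selected H (base H V (upTo T n₀)) ++ τ) = H (selected H (base H V (upTo T n₀)))
  · exact conjecture_eq_of_stable hV hW hH hρ hstab
  push Not at hstab
  obtain ⟨τ, hτ, hne⟩ := hstab
  by_contra hcon
  have hnot : ¬ content T ⊆ conjecture H V (base H V (upTo T n₀)) := fun h =>
    not_ssubset_conjecture hW hH hρ (h.ssubset_of_ne (Ne.symm hcon))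
  obtain ⟨x, hx, hxc⟩ := Set.not_subset.1 hnot
  obtain ⟨n, hn⟩ := exists_subset_listContent_upTo (T := T)
    ((listContent_finite τ).insert x) (Set.insert_subset hx hτ)
  -- By then `x` and the content of `τ` have appeared, the code of `τ` is within the search bound,
  -- and the base has converged.
  let m := max n (max n₀ (Encodable.encode τ))
  have hsub : insert x (listContent τ) ⊆ listContent (upTo T (m + 1)) :=
    hn.trans (listContent_upTo_mono T (by omega))
  have href : Refuted H V (base H V (upTo T m)) (upTo T (m + 1)) := by
    rw [h₀ m (by omega)]
    refine ⟨⟨Encodable.encode τ, by rw [length_upTo]; omega, ?_, by rwa [decodeSeq_encode]⟩, ?_⟩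
    · rw [decodeSeq_encode]
      exact (Set.subset_insert _ _).trans hsub
    · intro h
      rcases h (hsub (Set.mem_insert _ _)) with h | ⟨k, -, hk⟩
      · exact hxc (.inl h)
      · exact hxc (.inr ⟨k, hk⟩)
  -- The refutation puts the datum `x` into the base, which is nevertheless the limiting base, whose
  -- conjecture misses `x`.
  have he := base_upTo_succ_of_refuted href
  rw [h₀ (m + 1) (by omega)] at he
  exact hxc (.inl (he ▸ hsub (Set.mem_insert _ _)))

end Construction

/-! ### Computability of the construction -/

section Computability

open Primrec

theorem _root_.PrimrecRel.exists_nat_lt {α : Type*} [Primcodable α] {R : ℕ → α → Prop}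
    (hR : PrimrecRel R) : PrimrecRel fun n a => ∃ k < n, R k a :=
  (hR.exists_mem_list.comp (list_range.comp Primrec.fst) Primrec.snd).of_eq fun p => by simp

theorem _root_.PrimrecRel.forall_nat_lt {α : Type*} [Primcodable α] {R : ℕ → α → Prop}
    (hR : PrimrecRel R) : PrimrecRel fun n a => ∀ k < n, R k a :=
  (hR.forall_mem_list.comp (list_range.comp Primrec.fst) Primrec.snd).of_eq fun p => by simp

theorem primrec_decodeSeq : Primrec decodeSeq :=
  option_getD.comp Primrec.decode (const [])

theorem primrecRel_mem_listContent :
    PrimrecRel fun (x : ℕ) (ρ : List (Option ℕ)) => x ∈ listContent ρ := by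
  have h : PrimrecRel fun (ρ : List (Option ℕ)) (a : Option ℕ) => ∃ b ∈ ρ, b = a :=
    PrimrecRel.exists_mem_list Primrec.eq
  refine (h.comp Primrec.snd (option_some.comp Primrec.fst)).of_eq fun a => ?_
  simp [listContent]

/-- Rewrites inclusion as a bounded quantifier over list entries, a form that is visibly primitive
recursive. The default `0` concerns only pauses, which the first disjunct accepts. -/
theorem listContent_subset_iff {σ : List (Option ℕ)} {S : Set ℕ} :
    listContent σ ⊆ S ↔ ∀ a ∈ σ, a = none ∨ a.getD 0 ∈ S := by
  constructor
  · rintro h (_ | x) hx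
    · exact .inl rfl
    · exact .inr (h hx)
  · intro h x hx
    simpa using h (some x) hx

theorem primrecRel_listContent_subset {α : Type*} [Primcodable α] {S : α → Set ℕ}
    (hS : PrimrecRel fun (x : ℕ) a => x ∈ S a) :
    PrimrecRel fun (σ : List (Option ℕ)) a => listContent σ ⊆ S a := by
  have h : PrimrecRel fun (o : Option ℕ) (a : α) => o = none ∨ o.getD 0 ∈ S a :=
    (Primrec.eq.comp Primrec.fst (const none)).or
      (hS.comp (option_getD.comp Primrec.fst (const 0)) Primrec.snd)
  exact h.forall_mem_list.of_eq fun σ a => listContent_subset_iff.symm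

variable {H : List (Option ℕ) → ℕ} {V : ℕ → ℕ → Set ℕ}

theorem primrecRel_mismatch (hH : Primrec H) : PrimrecRel (Mismatch H) := by
  have h : PrimrecRel fun (c : ℕ) (a : List (Option ℕ) × List (Option ℕ)) =>
      listContent (decodeSeq c) ⊆ listContent a.2 ∧ H (a.1 ++ decodeSeq c) ≠ H a.1 := by
    have hc : Primrec fun p : ℕ × (List (Option ℕ) × List (Option ℕ)) => decodeSeq p.1 :=
      primrec_decodeSeq.comp Primrec.fst
    have hσ : Primrec fun p : ℕ × (List (Option ℕ) × List (Option ℕ)) => p.2.1 :=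
      Primrec.fst.comp Primrec.snd
    exact ((primrecRel_listContent_subset primrecRel_mem_listContent).comp hc
      (Primrec.snd.comp Primrec.snd)).and
        (Primrec.eq.comp (hH.comp (list_append.comp hσ hc)) (hH.comp hσ)).not
  have h' := h.exists_nat_lt
  exact h'.comp (succ.comp (list_length.comp Primrec.snd)) (Primrec.fst.pair Primrec.snd)

theorem primrecRel_looksStable (hH : Primrec H) : PrimrecRel (LooksStable H) := by
  have hc : Primrec fun p : List (Option ℕ) × ℕ => decodeSeq p.2 :=
    primrec_decodeSeq.comp Primrec.snd
  exact ((primrecRel_listContent_subset primrecRel_mem_listContent).comp hc Primrec.fst).and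
    ((primrecRel_mismatch hH).comp hc Primrec.fst).not

open Classical in
theorem primrec_selected (hH : Primrec H) : Primrec (selected H) := by
  have h : PrimrecRel fun (c : ℕ) (ρ : List (Option ℕ)) => LooksStable H ρ c :=
    (primrecRel_looksStable hH).swap
  have h' : Primrec (selectedCode H) := list_headI.comp
    (h.listFilter.comp (list_range.comp (succ.comp list_length)) Primrec.id)
  exact primrec_decodeSeq.comp h'

theorem primrecRel_goodStage (hH : Primrec H)
    (hV : PrimrecRel fun (x : ℕ) (p : ℕ × ℕ) => x ∈ V p.1 p.2) :
    PrimrecRel (GoodStage H V) := by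
  have hsub := primrecRel_listContent_subset hV
  have hs := primrec_selected hH
  have h : PrimrecRel fun (c : ℕ) (a : List (Option ℕ) × ℕ) =>
      listContent (decodeSeq c) ⊆ V (H (selected H a.1)) a.2 →
        H (selected H a.1 ++ decodeSeq c) = H (selected H a.1) := by
    have hc : Primrec fun p : ℕ × (List (Option ℕ) × ℕ) => decodeSeq p.1 :=
      primrec_decodeSeq.comp Primrec.fst
    have hσ : Primrec fun p : ℕ × (List (Option ℕ) × ℕ) => selected H p.2.1 :=
      hs.comp (Primrec.fst.comp Primrec.snd)
    have h₁ := (hsub.comp hc ((hH.comp hσ).pair (Primrec.snd.comp Primrec.snd))).not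
    have h₂ := Primrec.eq.comp (hH.comp (list_append.comp hσ hc)) (hH.comp hσ)
    exact (h₁.or h₂).of_eq fun p => imp_iff_not_or.symm
  have h' := h.forall_nat_lt
  exact (hsub.comp Primrec.fst ((hH.comp (hs.comp Primrec.fst)).pair Primrec.snd)).and
    (h'.comp (succ.comp Primrec.snd) (Primrec.fst.pair Primrec.snd))

/-- Enumeration of `conjecture H V ρ` in stages. -/
theorem primrecRel_conjecture_stage (hH : Primrec H)
    (hV : PrimrecRel fun (x : ℕ) (p : ℕ × ℕ) => x ∈ V p.1 p.2) :
    PrimrecRel fun (k : ℕ) (a : List (Option ℕ) × ℕ) =>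
      GoodStage H V a.1 k ∧ a.2 ∈ V (H (selected H a.1)) k :=
  ((primrecRel_goodStage hH hV).comp (Primrec.fst.comp Primrec.snd) Primrec.fst).and
    (hV.comp (Primrec.snd.comp Primrec.snd)
      ((hH.comp ((primrec_selected hH).comp (Primrec.fst.comp Primrec.snd))).pair Primrec.fst))

theorem primrecRel_refuted (hH : Primrec H)
    (hV : PrimrecRel fun (x : ℕ) (p : ℕ × ℕ) => x ∈ V p.1 p.2) :
    PrimrecRel (Refuted H V) := by
  have hlt := (primrecRel_conjecture_stage hH hV).exists_nat_lt
  have h : PrimrecRel fun (x : ℕ) (a : List (Option ℕ) × ℕ) => x ∈ conjectureBefore H V a.1 a.2 :=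
    (primrecRel_mem_listContent.comp Primrec.fst (Primrec.fst.comp Primrec.snd)).or
      (hlt.comp (Primrec.snd.comp Primrec.snd)
        ((Primrec.fst.comp Primrec.snd).pair Primrec.fst))
  exact ((primrecRel_mismatch hH).comp ((primrec_selected hH).comp Primrec.fst) Primrec.snd).and
    ((primrecRel_listContent_subset h).comp Primrec.snd
      (Primrec.fst.pair (succ.comp (list_length.comp Primrec.snd)))).not

open Classical in
theorem primrec_base (hH : Primrec H)
    (hV : PrimrecRel fun (x : ℕ) (p : ℕ × ℕ) => x ∈ V p.1 p.2) :
    Primrec (base H V) := by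
  have hstep : Primrec₂ (baseStep H V) := by
    have hpre : Primrec fun p : (List (Option ℕ) × List (Option ℕ)) × Option ℕ =>
        p.1.1 ++ [p.2] := list_concat.comp (Primrec.fst.comp Primrec.fst) Primrec.snd
    have hbase : Primrec fun p : (List (Option ℕ) × List (Option ℕ)) × Option ℕ => p.1.2 :=
      Primrec.snd.comp Primrec.fst
    exact hpre.pair (Primrec.ite ((primrecRel_refuted hH hV).comp hbase hpre) hpre hbase)
  exact Primrec.snd.comp (list_foldl Primrec.id (const ([], []))
    (hstep.comp₂ (Primrec.fst.comp₂ Primrec₂.right) (Primrec.snd.comp₂ Primrec₂.right)))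

open Classical in
theorem exists_index_conjecture {φ : ℕ → ℕ →. ℕ} (hφ : IsAcceptable φ) (hH : Primrec H)
    (hV : PrimrecRel fun (x : ℕ) (p : ℕ × ℕ) => x ∈ V p.1 p.2) :
    ∃ F : List (Option ℕ) → ℕ, Computable F ∧ ∀ ρ, W φ (F ρ) = conjecture H V ρ := by
  -- Unbounded search for `k` halts exactly on the members of the conjecture; acceptability then
  -- supplies its index computably in `ρ`.
  let R (a : ℕ × ℕ) (k : ℕ) : Prop := a.2 ∈ listContent (decodeSeq a.1) ∨
    (GoodStage H V (decodeSeq a.1) k ∧ a.2 ∈ V (H (selected H (decodeSeq a.1))) k)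
  have hR : PrimrecRel R :=
    have hρ : Primrec fun p : (ℕ × ℕ) × ℕ => decodeSeq p.1.1 :=
      primrec_decodeSeq.comp (Primrec.fst.comp Primrec.fst)
    have hx : Primrec fun p : (ℕ × ℕ) × ℕ => p.1.2 := Primrec.snd.comp Primrec.fst
    (primrecRel_mem_listContent.comp hx hρ).or
      ((primrecRel_conjecture_stage hH hV).comp Primrec.snd (hρ.pair hx))
  have hp : Partrec₂ fun (a : ℕ × ℕ) (k : ℕ) => (Part.some (decide (R a k)) : Part Bool) :=
    hR.decide.to_comp.partrec
  obtain ⟨f, hf, hfψ⟩ := hφ.2 (fun e x => Nat.rfind fun k => Part.some (decide (R (e, x) k)))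
    (Partrec.rfind hp)
  refine ⟨fun ρ => f (Encodable.encode ρ), hf.comp Computable.encode, fun ρ => Set.ext fun x => ?_⟩
  change (φ (f (Encodable.encode ρ)) x).Dom ↔ _
  rw [hfψ]
  refine Nat.rfind_dom.trans ?_
  simp [conjecture, R, decodeSeq_encode, exists_or]

/-- The finite approximations to the domains of an effective numbering. -/
theorem exists_approximation {φ : ℕ → ℕ →. ℕ} (hφ : Partrec₂ φ) :
    ∃ V : ℕ → ℕ → Set ℕ, (PrimrecRel fun (x : ℕ) (p : ℕ × ℕ) => x ∈ V p.1 p.2) ∧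
      (∀ e, Monotone (V e)) ∧ ∀ e, W φ e = ⋃ k, V e k := by
  obtain ⟨c, hc⟩ := Code.exists_code.1 (Partrec₂.unpaired'.2 hφ)
  refine ⟨fun e k => {x | (c.evaln k (Nat.pair e x)).isSome}, ?_, ?_, ?_⟩
  · refine PrimrecPred.of_eq (p := fun p : ℕ × (ℕ × ℕ) =>
      (c.evaln p.2.2 (Nat.pair p.2.1 p.1)).isSome = true) ?_ fun p => Iff.rfl
    refine Primrec.eq.comp (option_isSome.comp (Code.primrec_evaln.comp
      (((Primrec.snd.comp Primrec.snd).pair (const c)).pair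
        (Primrec₂.natPair.comp (Primrec.fst.comp Primrec.snd) Primrec.fst)))) (const true)
  · intro e k l hkl x hx
    obtain ⟨y, hy⟩ := Option.isSome_iff_exists.1 hx
    exact Option.isSome_iff_exists.2 ⟨y, Code.evaln_mono hkl hy⟩
  · intro e
    ext x
    have he : φ e x = c.eval (Nat.pair e x) := by simp [hc]
    rw [W, PFun.mem_dom, he]
    simp only [Code.evaln_complete, Set.mem_iUnion, Set.mem_ofPred_eq, Option.isSome_iff_exists,
      Option.mem_def]
    exact exists_comm

/-- Provides a default hypothesis that cannot overgeneralise any target. -/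
theorem exists_index_empty {φ : ℕ → ℕ →. ℕ} (hφ : IsAcceptable φ) : ∃ e, W φ e = ∅ := by
  obtain ⟨f, -, hf⟩ := hφ.2 (fun _ _ => Part.none) Partrec.none
  refine ⟨f 0, Set.ext fun x => ?_⟩
  simp [W, hf]

end Computability

/-! ### Totalising a learner -/

/-- The value of the code `c` on the longest prefix of `σ` on which it halts within `σ.length`
steps, or `e₀` if there is none. -/
def totalise (c : Code) (e₀ : ℕ) (σ : List (Option ℕ)) : ℕ :=
  (c.evaln σ.length (Encodable.encode (σ.take (Nat.findGreatest (fun k =>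
    (c.evaln σ.length (Encodable.encode (σ.take k))).isSome) σ.length)))).getD e₀

theorem primrec_totalise (c : Code) (e₀ : ℕ) : Primrec (totalise c e₀) := by
  have h : Primrec₂ fun (σ : List (Option ℕ)) (k : ℕ) =>
      c.evaln σ.length (Encodable.encode (σ.take k)) :=
    Code.primrec_evaln.comp (((Primrec.list_length.comp Primrec.fst).pair (Primrec.const c)).pair
      (Primrec.encode.comp (Primrec.list_take.comp Primrec.snd Primrec.fst)))
  have h' : PrimrecRel fun (σ : List (Option ℕ)) (k : ℕ) =>
      (c.evaln σ.length (Encodable.encode (σ.take k))).isSome = true :=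
    Primrec.eq.comp (Primrec.option_isSome.comp h) (Primrec.const true)
  exact Primrec.option_getD.comp
    (h.comp Primrec.id (Primrec.nat_findGreatest Primrec.list_length h')) (Primrec.const e₀)

/-- Totalising adds no new hypotheses except the default, so it cannot introduce overgeneralisation.
-/
theorem totalise_eq_or (c : Code) (e₀ : ℕ) (σ : List (Option ℕ)) :
    totalise c e₀ σ = e₀ ∨
      ∃ k ≤ σ.length, totalise c e₀ σ ∈ c.eval (Encodable.encode (σ.take k)) := by
  unfold totalise
  set k := Nat.findGreatest (fun k =>
    (c.evaln σ.length (Encodable.encode (σ.take k))).isSome) σ.length with hk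
  rcases h : c.evaln σ.length (Encodable.encode (σ.take k)) with _ | v
  · exact .inl rfl
  · exact .inr ⟨k, Nat.findGreatest_le _, Code.evaln_sound h⟩

/-- Once the step bound suffices for the prefix of length `n₀`, the longest halting prefix has
length at least `n₀`, where the values have already converged. -/
theorem totalise_eventually (c : Code) (e₀ : ℕ) {T : Text} {q : ℕ → ℕ} {n₀ : ℕ}
    (hq : ∀ i, q i ∈ c.eval (Encodable.encode (upTo T i))) (hn₀ : ∀ n ≥ n₀, q n = q n₀) :
    ∃ n₁, ∀ n ≥ n₁, totalise c e₀ (upTo T n) = q n₀ := by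
  obtain ⟨k₀, hk₀⟩ := Code.evaln_complete.1 (hq n₀)
  refine ⟨max n₀ k₀, fun n hn => ?_⟩
  unfold totalise
  rw [length_upTo]
  set P : ℕ → Prop := fun k => (c.evaln n (Encodable.encode ((upTo T n).take k))).isSome with hP
  have hPn : P n₀ := by
    rw [hP]
    simp only [take_upTo T (show n₀ ≤ n by omega)]
    exact Option.isSome_iff_exists.2 ⟨_, Code.evaln_mono (by omega) hk₀⟩
  have hge : n₀ ≤ Nat.findGreatest P n := Nat.le_findGreatest (by omega) hPn
  have hspec : P (Nat.findGreatest P n) := Nat.findGreatest_spec (m := n₀) (by omega) hPn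
  obtain ⟨v, hv⟩ := Option.isSome_iff_exists.1 hspec
  rw [hv, Option.getD_some]
  rw [take_upTo T (Nat.findGreatest_le n)] at hv
  rw [Part.mem_unique (Code.evaln_sound hv) (hq _), hn₀ _ hge]

/-- A partial learner that learns every `L ∈ 𝓛` explanatorily and never conjectures a proper
superset of the target can be replaced by a total one. -/
theorem exists_targetCautious {φ : ℕ → ℕ →. ℕ} (hφ : IsAcceptable φ)
    {h : List (Option ℕ) →. ℕ} (hh : Partrec h) :
    ∃ H : List (Option ℕ) → ℕ, Primrec H ∧ ∀ L : Set ℕ,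
      (∀ T : Text, content T = L → ∃ q : ℕ → ℕ, (∀ i, q i ∈ h (upTo T i)) ∧
        (∀ i, ¬ L ⊂ W φ (q i)) ∧ ∃ n₀, ∀ n, n₀ ≤ n → q n = q n₀ ∧ W φ (q n₀) = content T) →
      TargetCautious φ H L := by
  obtain ⟨e₀, he₀⟩ := exists_index_empty hφ
  obtain ⟨c, hc⟩ := Code.exists_code.1 hh
  have hceval : ∀ σ, c.eval (Encodable.encode σ) = h σ := by
    intro σ
    rw [hc]
    simp [Part.map_id']
  refine ⟨totalise c e₀, primrec_totalise c e₀, fun L hL => ⟨fun T hT => ?_, fun σ hσ => ?_⟩⟩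
  · obtain ⟨q, hq, -, n₀, hn₀⟩ := hL T hT
    obtain ⟨n₁, hn₁⟩ := totalise_eventually c e₀ (fun i => (hceval _).symm ▸ hq i)
      fun n hn => (hn₀ n hn).1
    refine ⟨n₁, fun n hn => ⟨by rw [hn₁ n hn, hn₁ n₁ le_rfl], ?_⟩⟩
    rw [hn₁ n₁ le_rfl, (hn₀ n₀ le_rfl).2, hT]
  -- Embedding `σ` in a text for `L` transfers the hypothesis on texts to every prefix of `σ`.
  · obtain ⟨T, hT, hTσ⟩ := exists_text_extending hσ
    obtain ⟨q, hq, hcaut, -⟩ := hL T hT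
    rcases totalise_eq_or c e₀ σ with he | ⟨k, hk, hmem⟩
    · rw [he, he₀]
      exact fun hss => hss.not_subset (Set.empty_subset _)
    · rw [hceval, ← hTσ, take_upTo T hk, hTσ] at hmem
      rw [Part.mem_unique hmem (hq k)]
      exact hcaut k

/-! ### The three learning criteria coincide -/

/-- Lets two restrictions on the same partial sequence share one total witness, since its values are
unique. -/
theorem whenTotal_iff {δ : (ℕ → ℕ) → Text → Prop} {p : ℕ →. ℕ} {q : ℕ → ℕ} {T : Text}
    (hq : ∀ i, q i ∈ p i) : whenTotal δ p T ↔ δ q T := by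
  refine ⟨?_, fun h => ⟨q, hq, h⟩⟩
  rintro ⟨q', hq', h⟩
  rwa [show q = q' from funext fun i => Part.mem_unique (hq i) (hq' i)]

/-- Classes learnable by a learner that never overgeneralises the target are learnable both
conservatively and cautiously. -/
theorem mem_TxtG_of_targetCautious {φ : ℕ → ℕ →. ℕ} (hφ : IsAcceptable φ) {𝓛 : Set (Set ℕ)}
    (h𝓛 : ∀ L ∈ 𝓛, IsLanguage L) {H : List (Option ℕ) → ℕ} (hH : Primrec H)
    (hL : ∀ L ∈ 𝓛, TargetCautious φ H L) :
    𝓛 ∈ TxtG (Conv φ ⊓ Ex φ) ∧ 𝓛 ∈ TxtG (Caut φ ⊓ Ex φ) := by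
  obtain ⟨V, hVp, hV, hW⟩ := exists_approximation hφ.1
  obtain ⟨F, hF, hFW⟩ := exists_index_conjecture hφ hH hVp
  have hcomp : Partrec fun ρ => (Part.some (F (base H V ρ)) : Part ℕ) :=
    (hF.comp (primrec_base hH hVp).to_comp).partrec
  have htotal : ∀ (T : Text) (i : ℕ), F (base H V (upTo T i)) ∈
      gold (fun ρ => (Part.some (F (base H V ρ)) : Part ℕ)) T i := fun T i => Part.mem_some _
  have hex : ∀ L ∈ 𝓛, ∀ T : Text, content T = L →
      Ex φ (gold (fun ρ => (Part.some (F (base H V ρ)) : Part ℕ)) T) T := by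
    intro L hLm T hT
    obtain ⟨n₀, hn₀⟩ := exists_base_eventually_eq (V := V) (hL L hLm) hT
    refine ⟨_, htotal T, n₀, fun n hn => ⟨congrArg F (hn₀ n hn), ?_⟩⟩
    rw [hFW, hT]
    exact conjecture_eq_of_base_eventually_eq hV hW (hL L hLm) hT hn₀
  refine ⟨⟨h𝓛, _, hcomp, fun L hLm T hT => ⟨⟨_, htotal T, fun i hi => ?_⟩, hex L hLm T hT⟩⟩,
    ⟨h𝓛, _, hcomp, fun L hLm T hT => ⟨⟨_, htotal T, fun i j hij => ?_⟩, hex L hLm T hT⟩⟩⟩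
  · rw [hFW] at hi
    rw [base_upTo_succ_of_not_refuted fun href => href.not_subset hV hi]
  · by_contra! hji
    rw [hFW, hFW] at hij
    rcases base_eq_or_not_subset (H := H) hV T hji with h | h
    · rw [h] at hij
      exact hij.ne rfl
    · exact h ((listContent_subset_conjecture _).trans hij.subset)

/-- While the data up to `j` are consistent with the hypothesis at `i`, conservativeness keeps it
syntactically unchanged. -/
theorem Conv.wMon {φ : ℕ → ℕ →. ℕ} {p : ℕ →. ℕ} {T : Text} (h : Conv φ p T) : WMon φ p T := by
  obtain ⟨q, hq, hconv⟩ := h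
  refine ⟨q, hq, fun i j ⟨hij, hsub⟩ => ?_⟩
  have : ∀ k, i ≤ k → k ≤ j → q k = q i := by
    intro k hik
    induction k, hik using Nat.le_induction with
    | base => exact fun _ => rfl
    | succ k hik ih =>
      intro hkj
      rw [← hconv k, ih (by omega)]
      rw [ih (by omega)]
      exact (listContent_upTo_mono T hkj).trans hsub
  rw [this j hij.le le_rfl]

theorem exists_targetCautious_of_mem_TxtG {φ : ℕ → ℕ →. ℕ} (hφ : IsAcceptable φ)
    {δ : (ℕ → ℕ) → Text → Prop} {𝓛 : Set (Set ℕ)} (h𝓛 : 𝓛 ∈ TxtG (whenTotal δ ⊓ Ex φ))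
    (hδ : ∀ (q : ℕ → ℕ) (T : Text) (n₀ : ℕ), δ q T →
      (∀ n, n₀ ≤ n → q n = q n₀ ∧ W φ (q n₀) = content T) → ∀ i, ¬ content T ⊂ W φ (q i)) :
    ∃ H : List (Option ℕ) → ℕ, Primrec H ∧ ∀ L ∈ 𝓛, TargetCautious φ H L := by
  obtain ⟨-, h, hh, hlearn⟩ := h𝓛
  obtain ⟨H, hH, hTC⟩ := exists_targetCautious hφ hh
  refine ⟨H, hH, fun L hL => hTC L fun T hT => ?_⟩
  obtain ⟨⟨q, hq, hδq⟩, hex⟩ := hlearn L hL T hT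
  obtain ⟨n₀, hn₀⟩ := (whenTotal_iff hq).1 hex
  exact ⟨q, hq, hT ▸ hδ q T n₀ hδq hn₀, n₀, hn₀⟩

end InductiveInference

theorem mainTheorem3 (φ : ℕ → ℕ →. ℕ) (hφ : InductiveInference.IsAcceptable φ) :
    InductiveInference.TxtG (InductiveInference.Conv φ ⊓ InductiveInference.Ex φ)
        = InductiveInference.TxtG (InductiveInference.WMon φ ⊓ InductiveInference.Ex φ) ∧
      InductiveInference.TxtG (InductiveInference.WMon φ ⊓ InductiveInference.Ex φ)
        = InductiveInference.TxtG (InductiveInference.Caut φ ⊓ InductiveInference.Ex φ) := by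
  open InductiveInference in
  have hcw : TxtG (Conv φ ⊓ Ex φ) ⊆ TxtG (WMon φ ⊓ Ex φ) := by
    rintro 𝓛 ⟨h𝓛, h, hh, hlearn⟩
    exact ⟨h𝓛, h, hh, fun L hL T hT => ⟨(hlearn L hL T hT).1.wMon, (hlearn L hL T hT).2⟩⟩
  have hw : ∀ 𝓛 ∈ TxtG (WMon φ ⊓ Ex φ),
      𝓛 ∈ TxtG (Conv φ ⊓ Ex φ) ∧ 𝓛 ∈ TxtG (Caut φ ⊓ Ex φ) := by
    intro 𝓛 h𝓛
    obtain ⟨H, hH, hTC⟩ := exists_targetCautious_of_mem_TxtG hφ h𝓛 fun q T n₀ hq hn₀ i hss => by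
      -- The index lies after `i` and past convergence, so the overlarge set would have to be
      -- contained in the target.
      have hsub := hq i (max n₀ (i + 1))
        ⟨by omega, (listContent_upTo_subset T _).trans hss.subset⟩
      rw [(hn₀ _ (le_max_left _ _)).1, (hn₀ n₀ le_rfl).2] at hsub
      exact hss.not_subset hsub
    exact mem_TxtG_of_targetCautious hφ h𝓛.1 hH hTC
  have hc : ∀ 𝓛 ∈ TxtG (Caut φ ⊓ Ex φ), 𝓛 ∈ TxtG (Conv φ ⊓ Ex φ) := by
    intro 𝓛 h𝓛
    obtain ⟨H, hH, hTC⟩ := exists_targetCautious_of_mem_TxtG hφ h𝓛 fun q T n₀ hq hn₀ i hss => by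
      -- The hypothesis at `max n₀ i` is correct, so caution would place it before the overlarge one
      -- at `i`.
      have hlt := hq (max n₀ i) i
        (by rwa [(hn₀ _ (le_max_left _ _)).1, (hn₀ n₀ le_rfl).2])
      omega
    exact (mem_TxtG_of_targetCautious hφ h𝓛.1 hH hTC).1
  exact ⟨hcw.antisymm fun 𝓛 h => (hw 𝓛 h).1,
    Set.Subset.antisymm (fun 𝓛 h => (hw 𝓛 h).2) fun 𝓛 h => hcw (hc 𝓛 h)⟩
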